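/- Let $\bm{Y}\in\mathbb{R}^{n\times p}$, let $\bm{x}\in\mathbb{R}^n$ with $\|\bm{x}\|_2=1$, let $t>0$, and set $\bm{c}=\bm{Y}^\top\bm{x}$. Consider the problem \[ (\mathrm{P})\qquad \min_{\bm{d}\in\mathbb{R}^n,\ \bm{u}\in\mathbb{R}^p}\ \tfrac12\|\bm{d}\|_2^2+t\|\bm{u}\|_1\quad\text{s.t.}\quad \bm{Y}^\top\bm{d}+\bm{c}=\bm{u},\quad \bm{d}^\top\bm{x}=0, \] and its augmented Lagrangian \[ \mathcal{L}_\sigma(\bm{d},\bm{u};y,\bm{z})=\tfrac12\|\bm{d}\|_2^2+t\|\bm{u}\|_1+y\,\bm{d}^\top\bm{x}+\langle\bm{z},\bm{Y}^\top\bm{d}+\bm{c}-\bm{u}\rangle+\tfrac{\sigma}{2}(\bm{d}^\top\bm{x})^2+\tfrac{\sigma}{2}\|\bm{Y}^\top\bm{d}+\bm{c}-\bm{u}\|_2^2 . \] Let $0<\sigma_0\le\sigma_1\le\cdots$, let $(\bm{d}^0,\bm{u}^0,y^0,\bm{z}^0)$ be arbitrary, and let $\{(\bm{d}^j,\bm{u}^j,y^j,\bm{z}^j)\}_j\subset\mathbb{R}^n\times\mathbb{R}^p\times\mathbb{R}\times\mathbb{R}^p$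 be generated by the inexact augmented Lagrangian method: in step $j$, $(\bm{d}^{j+1},\bm{u}^{j+1})$ is an approximate minimizer of $\Psi_j:=\mathcal{L}_{\sigma_j}(\cdot,\cdot;y^j,\bm{z}^j)$, in the sense of the criteria below, and \[ y^{j+1}=y^j+\sigma_j(\bm{d}^{j+1})^\top\bm{x},\qquad \bm{z}^{j+1}=\bm{z}^j+\sigma_j(\bm{Y}^\top\bm{d}^{j+1}+\bm{c}-\bm{u}^{j+1}). \] Write $\Psi_j^*=\inf\Psi_j$ and $\Delta_j=\|(y^{j+1},\bm{z}^{j+1})-(y^j,\bm{z}^j)\|_2$, and consider the following criteria, required for all $j\ge0$: (A) $\Psi_j(\bm{d}^{j+1},\bm{u}^{j+1})-\Psi_j^*\le\varepsilon_j^2/(2\sigma_j)$, where $\varepsilon_j\ge0$ and $\sum_{j}\varepsilon_j<\infty$; (B) $\Psi_j(\bm{d}^{j+1},\bm{u}^{j+1})-\Psi_j^*\le\frac{\delta_j^2}{2\sigma_j}\Delta_j^2$, where $\delta_j\ge0$ and $\sum_{j}\delta_j<\infty$; (C) $\operatorname{dist}(\bm{0},\partial\Psi_j(\bm{d}^{j+1},\bm{u}^{j+1}))\le\frac{\delta_j'}{\sigma_j}\Delta_j$,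 where $\delta_j'\ge0$ and $\delta'_j\to0$. Suppose that (A) holds. Then problem (P) has a unique optimal solution, and the sequence $\{(\bm{d}^j,\bm{u}^j)\}_j$ is bounded and converges to it. Suppose moreover that $\sigma_j\to\infty$ and that (B) and (C) hold as well. Let $\mathcal{K}$ be the set of KKT points of (P), i.e., of all $(\bm{d},\bm{u},y,\bm{z})$ with \[ \bm{d}+y\bm{x}+\bm{Y}\bm{z}=\bm{0},\qquad \bm{z}\in t\,\partial\|\bm{u}\|_1,\qquad \bm{Y}^\top\bm{d}+\bm{c}=\bm{u},\qquad \bm{d}^\top\bm{x}=0 . \] Then $\mathcal{K}\ne\emptyset$, and $\bm{w}^j:=(\bm{d}^j,\bm{u}^j,y^j,\bm{z}^j)$ converges asymptotically superlinearly to $\mathcal{K}$: $\operatorname{dist}(\bm{w}^j,\mathcal{K})\to0$, and there are $\theta_j\to0$ with $\operatorname{dist}(\bm{w}^{j+1},\mathcal{K})\le\theta_j\operatorname{dist}(\bm{w}^j,\mathcal{K})$ for all sufficiently large $j$. -/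

import Mathlib

open Filter Topology

noncomputable section

namespace ManPPA

/-- `ℝⁿ` with the Euclidean norm. -/
abbrev Vec (n : ℕ) := EuclideanSpace ℝ (Fin n)

/-- Primal variables `(d, u) ∈ ℝⁿ × ℝᵖ`, with the Euclidean norm of `ℝⁿ⁺ᵖ`. -/
abbrev Primal (n p : ℕ) := WithLp 2 (Vec n × Vec p)

/-- Dual variables `(y, z) ∈ ℝ × ℝᵖ`, with the Euclidean norm of `ℝ¹⁺ᵖ`. -/
abbrev Dual (p : ℕ) := WithLp 2 (ℝ × Vec p)

/-- Primal-dual points `(d, u, y, z)`, with the Euclidean norm. -/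
abbrev PrimalDual (n p : ℕ) := WithLp 2 (Primal n p × Dual p)

/-- The primal point `(d, u)`. -/
def primalPt {n p : ℕ} (d : Vec n) (u : Vec p) : Primal n p := WithLp.toLp 2 (d, u)

/-- The dual point `(y, z)`. -/
def dualPt {p : ℕ} (y : ℝ) (z : Vec p) : Dual p := WithLp.toLp 2 (y, z)

/-- The primal-dual point `(d, u, y, z)`. -/
def primalDualPt {n p : ℕ} (d : Vec n) (u : Vec p) (y : ℝ) (z : Vec p) : PrimalDual n p :=
  WithLp.toLp 2 (primalPt d u, dualPt y z)

/-- The matrix-vector product between Euclidean spaces. -/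
def mulVec {m k : ℕ} (A : Matrix (Fin m) (Fin k) ℝ) (v : Vec k) : Vec m :=
  WithLp.toLp 2 (Matrix.mulVec A v.ofLp)

/-- The `ℓ₁` norm `‖u‖₁`. -/
def l1 {p : ℕ} (u : Vec p) : ℝ := ∑ i, |u i|

/-- The convex subdifferential of a real-valued function:
`∂f(w) = {g | f(v) ≥ f(w) + ⟨g, v - w⟩ for all v}`. -/
def subdiff {E : Type*} [NormedAddCommGroup E] [InnerProductSpace ℝ E] (f : E → ℝ) (w : E) :
    Set E :=
  {g | ∀ v, f w + inner ℝ g (v - w) ≤ f v}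

section Problem

variable {n p : ℕ} (Y : Matrix (Fin n) (Fin p) ℝ) (x : Vec n) (t : ℝ)

/-- The residual `Yᵀd + c - u`, where `c = Yᵀx`. -/
def residual (d : Vec n) (u : Vec p) : Vec p :=
  mulVec Y.transpose d + mulVec Y.transpose x - u

/-- The objective `½‖d‖₂² + t‖u‖₁`. -/
def objective (w : Primal n p) : ℝ := (1 / 2) * ‖w.fst‖ ^ 2 + t * l1 w.snd

/-- The feasible set `{(d, u) | Yᵀd + c = u, dᵀx = 0}`. -/
def feasible : Set (Primal n p) :=
  {w | mulVec Y.transpose w.fst + mulVec Y.transpose x = w.snd ∧ inner ℝ w.fst x = 0}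

/-- `w = (d, u)` is an optimal solution of
`min ½‖d‖₂² + t‖u‖₁  s.t.  Yᵀd + c = u, dᵀx = 0`. -/
def IsOptimal (w : Primal n p) : Prop :=
  w ∈ feasible Y x ∧ IsMinOn (objective t) (feasible Y x) w

/-- The augmented Lagrangian `L_σ(d, u; y, z)`, with `w = (d, u)`. -/
def augLagrangian (σ : ℝ) (w : Primal n p) (y : ℝ) (z : Vec p) : ℝ :=
  (1 / 2) * ‖w.fst‖ ^ 2 + t * l1 w.snd + y * inner ℝ w.fst x
    + inner ℝ z (residual Y x w.fst w.snd)
    + σ / 2 * (inner ℝ w.fst x) ^ 2 + σ / 2 * ‖residual Y x w.fst w.snd‖ ^ 2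

/-- The KKT points `(d, u, y, z)`, where `y` and `z` are the multipliers of `dᵀx = 0` and of
`Yᵀd + c - u = 0` in the Lagrangian
`½‖d‖₂² + t‖u‖₁ + y dᵀx + ⟨z, Yᵀd + c - u⟩`. -/
def kktSet : Set (PrimalDual n p) :=
  {w | ∃ (d : Vec n) (u : Vec p) (y : ℝ) (z : Vec p), w = primalDualPt d u y z ∧
    d + y • x + mulVec Y z = 0 ∧
    (∃ s ∈ subdiff (l1 (p := p)) u, z = t • s) ∧
    mulVec Y.transpose d + mulVec Y.transpose x = u ∧
    inner ℝ d x = 0}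

variable (σ : ℕ → ℝ) (d : ℕ → Vec n) (u : ℕ → Vec p) (y : ℕ → ℝ) (z : ℕ → Vec p)

/-- The function `Ψ_j(d, u) = L_{σ_j}(d, u; y_j, z_j)` minimized approximately in step `j`. -/
def Psi (j : ℕ) (w : Primal n p) : ℝ := augLagrangian Y x t (σ j) w (y j) (z j)

/-- The optimal value `Ψ_j^*`. -/
def PsiStar (j : ℕ) : ℝ := ⨅ w : Primal n p, Psi Y x t σ y z j w

/-- The penalty parameters are positive and nondecreasing, and the multipliers are updated by the
inexact ALM. How well `(d_{j+1}, u_{j+1})` minimizes `Ψ_j` is the subject of the stopping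
criteria; the initial points are arbitrary. -/
structure IsInexactALM : Prop where
  sigma_pos : ∀ j, 0 < σ j
  sigma_mono : Monotone σ
  y_update : ∀ j, y (j + 1) = y j + σ j * inner ℝ (d (j + 1)) x
  z_update : ∀ j, z (j + 1) = z j + σ j • residual Y x (d (j + 1)) (u (j + 1))

/-- Stopping criterion (A). -/
structure CriterionA (ε : ℕ → ℝ) : Prop where
  nonneg : ∀ j, 0 ≤ ε j
  summable : Summable ε
  le : ∀ j, Psi Y x t σ y z j (primalPt (d (j + 1)) (u (j + 1))) - PsiStar Y x t σ y z j
    ≤ ε j ^ 2 / (2 * σ j)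

/-- Stopping criterion (B). -/
structure CriterionB (δ : ℕ → ℝ) : Prop where
  nonneg : ∀ j, 0 ≤ δ j
  summable : Summable δ
  le : ∀ j, Psi Y x t σ y z j (primalPt (d (j + 1)) (u (j + 1))) - PsiStar Y x t σ y z j
    ≤ δ j ^ 2 / (2 * σ j) * ‖dualPt (y (j + 1)) (z (j + 1)) - dualPt (y j) (z j)‖ ^ 2

/-- Stopping criterion (C). -/
structure CriterionC (δ' : ℕ → ℝ) : Prop where
  nonneg : ∀ j, 0 ≤ δ' j
  tendsto_zero : Tendsto δ' atTop (𝓝 0)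
  le : ∀ j, Metric.infDist 0
      (subdiff (Psi Y x t σ y z j) (primalPt (d (j + 1)) (u (j + 1))))
    ≤ δ' j / σ j * ‖dualPt (y (j + 1)) (z (j + 1)) - dualPt (y j) (z j)‖

end Problem

/-- Asymptotic superlinear convergence of a sequence to a nonempty set `K`: its distance to `K`
tends to zero, and `dist(w_{j+1}, K) ≤ θ_j dist(w_j, K)` for all sufficiently large `j`, where
`θ_j → 0`. -/
def SuperlinearlyConvergesTo {E : Type*} [PseudoMetricSpace E] (w : ℕ → E) (K : Set E) : Prop :=
  K.Nonempty ∧ Tendsto (fun j => Metric.infDist (w j) K) atTop (𝓝 0) ∧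
    ∃ θ : ℕ → ℝ, Tendsto θ atTop (𝓝 0) ∧
      ∀ᶠ j in atTop, Metric.infDist (w (j + 1)) K ≤ θ j * Metric.infDist (w j) K

end ManPPA

end

/-! The method is treated as an inexact proximal point iteration on the dual, using only finite
inequalities. A KKT point exists because the dual is a convex quadratic over a box (`exists_isKKT`).
Strong convexity in `d`, with `u` fixed by feasibility, makes the primal solution unique.

One step decreases the squared distance from the multipliers to those of any KKT point by at least
half of Δ_j² plus σ_j times the squared error in `d`, up to twice the error allowance
(`IsKKT.step_le`). Under (A) the allowances are summable, so Δ_j and the errors in `d` and `u`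
vanish. No convergence of the multipliers is needed.

The rate combines three estimates. By (B) and the same decrease, Δ_j is at most twice the distance
from the current iterate to the KKT set. By (C), the new iterate has KKT residual O((δ'_j + 1)/σ_j)
Δ_j. Finally, for `u` near its limit, the distance to the KKT set is bounded by a multiple of that
residual (`IsKKT.error_bound`). This rests on Hoffman's bound for the multiplier polyhedron and
strong monotonicity in `d`. Since σ_j → ∞, the contraction factor tends to zero. -/

namespace ManPPA

/-! ### Hoffman's error bound -/

/-- A point violating finitely many pairwise compatible bounds by at most `η` can be moved by at
most `η` so as to satisfy them all. -/
theorem exists_between_of_finite {I J : Type*} [Finite I] [Finite J] {L : J → ℝ} {U : I → ℝ}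
    {c η : ℝ} (hη : 0 ≤ η) (hLU : ∀ i j, L j ≤ U i) (hL : ∀ j, L j ≤ c + η)
    (hU : ∀ i, c - η ≤ U i) :
    ∃ y, (∀ j, L j ≤ y) ∧ (∀ i, y ≤ U i) ∧ |c - y| ≤ η := by
  -- The extra index carries the bound `c - η`, so the supremum is over a nonempty family even when
  -- `J` is empty.
  let F : Option J → ℝ := fun o => o.elim (c - η) L
  have hb : BddAbove (Set.range F) := (Set.finite_range F).bddAbove
  refine ⟨⨆ o, F o, fun j => le_ciSup hb (some j), fun i => ciSup_le ?_, ?_⟩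
  · rintro (_ | j)
    exacts [hU i, hLU i j]
  · have h1 : c - η ≤ ⨆ o, F o := le_ciSup hb none
    have h2 : ⨆ o, F o ≤ c + η := ciSup_le (by
      rintro (_ | j)
      exacts [(by simp only [F, Option.elim]; linarith), hL j])
    rw [abs_le]
    constructor <;> linarith

theorem abs_dotProduct_le {n : ℕ} (a v : Fin n → ℝ) {s : ℝ} (hv : ∀ k, |v k| ≤ s) :
    |a ⬝ᵥ v| ≤ (∑ k, |a k|) * s := by
  rw [dotProduct, Finset.sum_mul]
  refine (Finset.abs_sum_le_sum_abs _ _).trans (Finset.sum_le_sum fun k _ => ?_)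
  rw [abs_mul]
  exact mul_le_mul_of_nonneg_left (hv k) (abs_nonneg _)

theorem dotProduct_eq_head_add_tail {n : ℕ} (a v : Fin (n + 1) → ℝ) :
    a ⬝ᵥ v = a 0 * v 0 + Fin.tail a ⬝ᵥ Fin.tail v := by
  simp [dotProduct, Fin.sum_univ_succ, Fin.tail]

/-- Hoffman's error bound for a system of linear inequalities, by Fourier-Motzkin elimination. -/
theorem hoffman (n : ℕ) : ∀ {ι : Type} [Fintype ι] (a : ι → Fin n → ℝ), ∃ κ : ℝ, 0 ≤ κ ∧
    ∀ (b : ι → ℝ) (ε : ℝ), 0 ≤ ε → (∃ y, ∀ i, a i ⬝ᵥ y ≤ b i) →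
      ∀ v, (∀ i, a i ⬝ᵥ v ≤ b i + ε) →
        ∃ y, (∀ i, a i ⬝ᵥ y ≤ b i) ∧ ∀ k, |v k - y k| ≤ κ * ε := by
  induction n with
  | zero =>
    intro ι _ a
    refine ⟨0, le_rfl, fun b ε _ ⟨y, hy⟩ v _ => ⟨y, hy, fun k => k.elim0⟩⟩
  | succ n ih =>
    intro ι _ a
    classical
    let α : ι → ℝ := fun i => a i 0
    let a' : ι → Fin n → ℝ := fun i => Fin.tail (a i)
    have hdot : ∀ i v, a i ⬝ᵥ v = α i * v 0 + a' i ⬝ᵥ Fin.tail v := fun i v =>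
      dotProduct_eq_head_add_tail _ _
    -- Rows free of the first coordinate survive; each upper bound on that coordinate is paired with
    -- each lower bound.
    let J := {i // α i = 0} ⊕ ({i // 0 < α i} × {i // α i < 0})
    let A : J → Fin n → ℝ := Sum.elim (fun i => a' i)
      (fun q => (α q.1)⁻¹ • a' q.1 - (α q.2)⁻¹ • a' q.2)
    obtain ⟨κ, hκ, H⟩ := ih A
    -- `1 ≤ M` lets the surviving rows, violated by at most `ε`, share the tolerance `2 * M * ε` of
    -- the paired rows.
    obtain ⟨M, hM1, hM⟩ : ∃ M : ℝ, 1 ≤ M ∧ ∀ i, |(α i)⁻¹| ≤ M := by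
      refine ⟨1 + ∑ i, |(α i)⁻¹|, ?_, fun i => ?_⟩
      · linarith [Finset.sum_nonneg fun i (_ : i ∈ Finset.univ) => abs_nonneg ((α i)⁻¹)]
      · linarith [Finset.single_le_sum (fun i _ => abs_nonneg ((α i)⁻¹)) (Finset.mem_univ i)]
    obtain ⟨N, hN0, hN⟩ : ∃ N : ℝ, 0 ≤ N ∧ ∀ i, ∑ k, |a' i k| ≤ N := by
      refine ⟨∑ i, ∑ k, |a' i k|, by positivity, fun i => ?_⟩
      exact Finset.single_le_sum (f := fun i => ∑ k, |a' i k|) (fun i _ => by positivity)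
        (Finset.mem_univ i)
    refine ⟨κ * (2 * M) + M * (1 + N * (κ * (2 * M))), by positivity,
      fun b ε hε ⟨y, hy⟩ v hv => ?_⟩
    let B : J → ℝ := Sum.elim (fun i => b i) (fun q => (α q.1)⁻¹ * b q.1 - (α q.2)⁻¹ * b q.2)
    have upper : ∀ (i : ι) (w : Fin (n + 1) → ℝ) (e : ℝ), 0 < α i → a i ⬝ᵥ w ≤ b i + e →
        w 0 ≤ (α i)⁻¹ * (b i + e - a' i ⬝ᵥ Fin.tail w) := by
      intro i w e hi h
      rw [hdot] at h
      rw [le_inv_mul_iff₀ hi]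
      linarith
    have lower : ∀ (i : ι) (w : Fin (n + 1) → ℝ) (e : ℝ), α i < 0 → a i ⬝ᵥ w ≤ b i + e →
        (α i)⁻¹ * (b i + e - a' i ⬝ᵥ Fin.tail w) ≤ w 0 := by
      intro i w e hi h
      rw [hdot] at h
      have h1 := mul_le_mul_of_nonpos_left
        (show α i * w 0 ≤ b i + e - a' i ⬝ᵥ Fin.tail w by linarith) (inv_lt_zero.2 hi).le
      rwa [inv_mul_cancel_left₀ hi.ne] at h1
    have hA : ∀ q : {i // 0 < α i} × {i // α i < 0}, ∀ w : Fin n → ℝ,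
        A (.inr q) ⬝ᵥ w = (α q.1)⁻¹ * (a' q.1 ⬝ᵥ w) - (α q.2)⁻¹ * (a' q.2 ⬝ᵥ w) := by
      intro q w
      simp [A, sub_dotProduct, smul_dotProduct]
    have hMe : ∀ i, |(α i)⁻¹ * ε| ≤ M * ε := fun i => by
      rw [abs_mul, abs_of_nonneg hε]
      exact mul_le_mul_of_nonneg_right (hM i) hε
    obtain ⟨y', hy', hd⟩ := H B (2 * M * ε) (by positivity) ⟨Fin.tail y, by
        rintro (i | q)
        · have := hy i
          rw [hdot, i.2] at this
          simpa [A, B] using this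
        · have h1 := upper q.1 y 0 q.1.2 (by simpa using hy q.1)
          have h2 := lower q.2 y 0 q.2.2 (by simpa using hy q.2)
          rw [hA]
          simp only [B, Sum.elim_inr]
          linarith⟩ (Fin.tail v) (by
        rintro (i | q)
        · have := hv i
          rw [hdot, i.2] at this
          simp only [A, B, Sum.elim_inl]
          nlinarith
        · have h1 := upper q.1 v ε q.1.2 (hv q.1)
          have h2 := lower q.2 v ε q.2.2 (hv q.2)
          have h3 := abs_le.1 (hMe q.1)
          have h4 := abs_le.1 (hMe q.2)
          rw [hA]
          simp only [B, Sum.elim_inr]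
          linarith)
    have hmove : ∀ i, |(α i)⁻¹ * (a' i ⬝ᵥ Fin.tail v - a' i ⬝ᵥ y')|
        ≤ M * (N * (κ * (2 * M * ε))) := by
      intro i
      rw [abs_mul, ← dotProduct_sub]
      refine mul_le_mul (hM i) ?_ (abs_nonneg _) (by linarith)
      refine (abs_dotProduct_le _ _ hd).trans ?_
      exact mul_le_mul_of_nonneg_right (hN i) (by positivity)
    -- Back-substitution: the eliminated rows say exactly that the bounds on the first coordinate
    -- are compatible. `η` adds the original violation to the shift of the bounds caused by moving
    -- the tail to `y'`.
    obtain ⟨y0, hL, hU, h0⟩ := exists_between_of_finite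
      (I := {i // 0 < α i}) (J := {i // α i < 0})
      (L := fun j => (α j)⁻¹ * (b j - a' j ⬝ᵥ y')) (U := fun i => (α i)⁻¹ * (b i - a' i ⬝ᵥ y'))
      (c := v 0) (η := M * (1 + N * (κ * (2 * M))) * ε) (by positivity)
      (by
        intro i j
        have := hy' (.inr (i, j))
        rw [hA] at this
        simp only [B, Sum.elim_inr] at this
        linarith)
      (by
        intro j
        have h2 := lower j v ε j.2 (hv j)
        have h3 := abs_le.1 (hMe j)
        have h4 := abs_le.1 (hmove j)
        linarith)
      (by
        intro i
        have h2 := upper i v ε i.2 (hv i)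
        have h3 := abs_le.1 (hMe i)
        have h4 := abs_le.1 (hmove i)
        linarith)
    refine ⟨Fin.cons y0 y', fun i => ?_, fun k => ?_⟩
    · rw [hdot, Fin.cons_zero, Fin.tail_cons]
      rcases lt_trichotomy (α i) 0 with h | h | h
      · have h1 := mul_le_mul_of_nonpos_left (hL ⟨i, h⟩) h.le
        simp only [mul_inv_cancel_left₀ h.ne] at h1
        linarith
      · have := hy' (.inl ⟨i, h⟩)
        simp only [A, B, Sum.elim_inl] at this
        simpa [h] using this
      · have h1 := mul_le_mul_of_nonneg_left (hU ⟨i, h⟩) h.le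
        simp only [mul_inv_cancel_left₀ h.ne'] at h1
        linarith
    · have hp1 : 0 ≤ κ * (2 * M) * ε := by positivity
      have hp2 : 0 ≤ M * (1 + N * (κ * (2 * M))) * ε := by positivity
      rw [add_mul]
      refine Fin.cases ?_ (fun k => ?_) k
      · rw [Fin.cons_zero]; linarith
      · rw [Fin.cons_succ]
        have := hd k
        simp only [Fin.tail] at this
        linarith

/-- Hoffman's error bound for a system of two-sided linear inequalities. -/
theorem hoffman_two_sided {n : ℕ} {ι : Type} [Fintype ι] (a : ι → Fin n → ℝ) :
    ∃ κ : ℝ, 0 ≤ κ ∧ ∀ (lo hi : ι → ℝ) (ε : ℝ), 0 ≤ ε →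
      (∃ y, ∀ i, lo i ≤ a i ⬝ᵥ y ∧ a i ⬝ᵥ y ≤ hi i) →
      ∀ v, (∀ i, lo i - ε ≤ a i ⬝ᵥ v ∧ a i ⬝ᵥ v ≤ hi i + ε) →
        ∃ y, (∀ i, lo i ≤ a i ⬝ᵥ y ∧ a i ⬝ᵥ y ≤ hi i) ∧ ∀ k, |v k - y k| ≤ κ * ε := by
  obtain ⟨κ, hκ, H⟩ := hoffman n (Sum.elim a fun i => -a i)
  refine ⟨κ, hκ, fun lo hi ε hε ⟨y, hy⟩ v hv => ?_⟩
  obtain ⟨y', h1, h2⟩ := H (Sum.elim hi fun i => -lo i) ε hε ⟨y, by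
      rintro (i | i)
      · exact (hy i).2
      · simpa [neg_dotProduct] using (hy i).1⟩ v (by
      rintro (i | i)
      · exact (hv i).2
      · have := (hv i).1
        simp only [Sum.elim_inr, neg_dotProduct]
        linarith)
  refine ⟨y', fun i => ⟨?_, h1 (.inl i)⟩, h2⟩
  simpa [neg_dotProduct] using h1 (.inr i)

end ManPPA

/-! ### Euclidean preliminaries -/

namespace ManPPA

@[simp] theorem primalPt_fst {n p : ℕ} (d : Vec n) (u : Vec p) : (primalPt d u).fst = d := rfl

@[simp] theorem primalPt_snd {n p : ℕ} (d : Vec n) (u : Vec p) : (primalPt d u).snd = u := rfl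

theorem mulVec_eq_toEuclideanLin {m k : ℕ} (A : Matrix (Fin m) (Fin k) ℝ) (v : Vec k) :
    mulVec A v = Matrix.toEuclideanLin A v := rfl

theorem mulVec_add {m k : ℕ} (A : Matrix (Fin m) (Fin k) ℝ) (v w : Vec k) :
    mulVec A (v + w) = mulVec A v + mulVec A w := by
  simp only [mulVec_eq_toEuclideanLin, map_add]

theorem mulVec_sub {m k : ℕ} (A : Matrix (Fin m) (Fin k) ℝ) (v w : Vec k) :
    mulVec A (v - w) = mulVec A v - mulVec A w := by
  simp only [mulVec_eq_toEuclideanLin, map_sub]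

theorem mulVec_smul {m k : ℕ} (A : Matrix (Fin m) (Fin k) ℝ) (c : ℝ) (v : Vec k) :
    mulVec A (c • v) = c • mulVec A v := by
  simp only [mulVec_eq_toEuclideanLin, map_smul]

theorem continuous_mulVec {m k : ℕ} (A : Matrix (Fin m) (Fin k) ℝ) :
    Continuous (mulVec A) :=
  (LinearMap.continuous_of_finiteDimensional (Matrix.toEuclideanLin A))

theorem exists_norm_mulVec_le {m k : ℕ} (A : Matrix (Fin m) (Fin k) ℝ) :
    ∃ a : ℝ, 0 ≤ a ∧ ∀ v, ‖mulVec A v‖ ≤ a * ‖v‖ :=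
  ⟨_, norm_nonneg _, (LinearMap.toContinuousLinearMap (Matrix.toEuclideanLin A)).le_opNorm⟩

theorem inner_eq_sum {k : ℕ} (v w : Vec k) : inner ℝ v w = ∑ i, v i * w i := by
  simp [PiLp.inner_apply, mul_comm]

theorem inner_mulVec {n p : ℕ} (Y : Matrix (Fin n) (Fin p) ℝ) (z : Vec p) (d : Vec n) :
    inner ℝ (mulVec Y z) d = inner ℝ z (mulVec Y.transpose d) := by
  simp only [inner_eq_sum, mulVec, Matrix.mulVec, dotProduct, Finset.sum_mul, Finset.mul_sum,
    Matrix.transpose_apply]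
  rw [Finset.sum_comm]
  exact Finset.sum_congr rfl fun i _ => Finset.sum_congr rfl fun k _ => by ring

theorem abs_apply_le_norm {k : ℕ} (v : Vec k) (i : Fin k) : |v i| ≤ ‖v‖ := by
  simpa using PiLp.norm_apply_le v i

theorem norm_le_l1 {k : ℕ} (v : Vec k) : ‖v‖ ≤ l1 v := by
  have h0 : 0 ≤ l1 v := Finset.sum_nonneg fun i _ => abs_nonneg _
  refine (sq_le_sq₀ (norm_nonneg v) h0).1 ?_
  rw [EuclideanSpace.real_norm_sq_eq, pow_two (l1 v), l1, Finset.sum_mul]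
  refine Finset.sum_le_sum fun i hi => ?_
  rw [← sq_abs, pow_two]
  exact mul_le_mul_of_nonneg_left
    (Finset.single_le_sum (fun j _ => abs_nonneg (v j)) hi) (abs_nonneg _)

theorem l1_add_smul_le {p : ℕ} (u b : Vec p) {s : ℝ} (h0 : 0 ≤ s) (h1 : s ≤ 1) :
    l1 (u + s • b) ≤ l1 u + s * (l1 (u + b) - l1 u) := by
  simp only [l1, ← Finset.sum_sub_distrib, Finset.mul_sum, ← Finset.sum_add_distrib]
  refine Finset.sum_le_sum fun i _ => ?_
  have h : (u + s • b) i = (1 - s) * u i + s * (u + b) i := by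
    simp; ring
  rw [h]
  refine (abs_add_le _ _).trans ?_
  rw [abs_mul, abs_mul, abs_of_nonneg h0, abs_of_nonneg (sub_nonneg.2 h1)]
  linarith

/-! ### Subgradients of the ℓ₁ norm -/

/-- `z ∈ t ∂‖u‖₁`, coordinatewise. -/
def IsL1Subgrad {p : ℕ} (t : ℝ) (u z : Vec p) : Prop :=
  ∀ i, |z i| ≤ t ∧ z i * u i = t * |u i|

theorem IsL1Subgrad.le {p : ℕ} {t : ℝ} {u z : Vec p} (h : IsL1Subgrad t u z) (v : Vec p) :
    t * l1 u + inner ℝ z (v - u) ≤ t * l1 v := by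
  rw [inner_eq_sum, l1, l1, Finset.mul_sum, Finset.mul_sum, ← Finset.sum_add_distrib]
  refine Finset.sum_le_sum fun i _ => ?_
  have h1 : z i * v i ≤ t * |v i| := by
    refine (le_abs_self _).trans ?_
    rw [abs_mul]
    exact mul_le_mul_of_nonneg_right (h i).1 (abs_nonneg _)
  have h2 := (h i).2
  simp only [PiLp.sub_apply]
  linarith

theorem isL1Subgrad_of_le {p : ℕ} {t : ℝ} {u z : Vec p} (ht : 0 < t)
    (h : ∀ b, t * l1 u + inner ℝ z b ≤ t * l1 (u + b)) : IsL1Subgrad t u z := by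
  intro i
  have key : ∀ a : ℝ, t * |u i| + z i * a ≤ t * |u i + a| := by
    intro a
    have h1 := h (EuclideanSpace.single i a)
    have h2 : inner ℝ z (EuclideanSpace.single i a) = z i * a := by
      simp [EuclideanSpace.inner_single_right, mul_comm]
    have h3 : l1 (u + EuclideanSpace.single i a) - l1 u = |u i + a| - |u i| := by
      rw [l1, l1, ← Finset.sum_sub_distrib, Finset.sum_eq_single i]
      · simp
      · intro j _ hj
        simp [hj]
      · simp
    rw [h2] at h1
    have h4 := congrArg (fun r => t * r) h3
    simp only [mul_sub] at h4
    linarith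
  -- The increments `∓u i` give the two halves of complementarity; `±1` give `|z i| ≤ t` by the
  -- triangle inequality.
  have k1 := key (-u i)
  have k2 := key (u i)
  have k3 := key 1
  have k4 := key (-1)
  have e1 : |u i + -u i| = 0 := by simp
  have e2 : |u i + u i| = 2 * |u i| := by rw [← two_mul, abs_mul, abs_two]
  have e3 : |u i + 1| ≤ |u i| + 1 := by simpa using abs_add_le (u i) 1
  have e4 : |u i + -1| ≤ |u i| + 1 := by simpa using abs_add_le (u i) (-1)
  rw [e1] at k1
  rw [e2] at k2
  refine ⟨abs_le.2 ⟨?_, ?_⟩, ?_⟩ <;> nlinarith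

theorem exists_isL1Subgrad {p : ℕ} {t : ℝ} (ht : 0 < t) (u : Vec p) :
    ∃ z, IsL1Subgrad t u z := by
  refine ⟨WithLp.toLp 2 fun i => if u i < 0 then -t else t, fun i => ?_⟩
  by_cases hi : u i < 0
  · simp [hi, abs_of_pos ht, abs_of_neg hi]
  · simp [hi, abs_of_pos ht, abs_of_nonneg (not_lt.1 hi)]

/-- Perturbing the base point without changing the nonzero signs keeps a subgradient. -/
theorem IsL1Subgrad.mul_eq_of_pos {p : ℕ} {t : ℝ} {u z : Vec p} (h : IsL1Subgrad t u z)
    {i : Fin p} {a : ℝ} (ha : 0 < u i * a) : z i * a = t * |a| := by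
  have h2 := (h i).2
  rcases pos_and_pos_or_neg_and_neg_of_mul_pos ha with ⟨hu, ha⟩ | ⟨hu, ha⟩
  · rw [abs_of_pos hu] at h2
    rw [abs_of_pos ha, mul_right_cancel₀ hu.ne' h2]
  · rw [abs_of_neg hu, mul_neg, ← neg_mul] at h2
    rw [abs_of_neg ha, mul_right_cancel₀ hu.ne h2]
    ring

/-! ### KKT points: saddle inequality, uniqueness, existence -/

section Problem

variable {n p : ℕ} {Y : Matrix (Fin n) (Fin p) ℝ} {x : Vec n} {t : ℝ}

/-- The KKT conditions in coordinates. -/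
structure IsKKT (Y : Matrix (Fin n) (Fin p) ℝ) (x : Vec n) (t : ℝ) (d : Vec n) (u : Vec p)
    (y : ℝ) (z : Vec p) : Prop where
  stationary : d + y • x + mulVec Y z = 0
  subgrad : IsL1Subgrad t u z
  residual_eq : residual Y x d u = 0
  orth : inner ℝ d x = 0

theorem IsKKT.feasible_eq {d : Vec n} {u : Vec p} {y : ℝ} {z : Vec p}
    (h : IsKKT Y x t d u y z) : mulVec Y.transpose d + mulVec Y.transpose x = u :=
  sub_eq_zero.1 h.residual_eq

theorem IsKKT.mem {d : Vec n} {u : Vec p} {y : ℝ} {z : Vec p} (ht : 0 < t)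
    (h : IsKKT Y x t d u y z) : primalDualPt d u y z ∈ kktSet Y x t := by
  refine ⟨d, u, y, z, rfl, h.stationary, ⟨t⁻¹ • z, fun v => ?_, ?_⟩, h.feasible_eq, h.orth⟩
  · have h1 := h.subgrad.le v
    rw [real_inner_smul_left]
    refine le_of_mul_le_mul_left ?_ ht
    rw [mul_add, mul_inv_cancel_left₀ ht.ne']
    exact h1
  · rw [smul_inv_smul₀ ht.ne']

theorem exists_isKKT_of_mem {w : PrimalDual n p} (ht : 0 < t) (h : w ∈ kktSet Y x t) :
    ∃ d u y z, w = primalDualPt d u y z ∧ IsKKT Y x t d u y z := by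
  obtain ⟨d, u, y, z, rfl, h1, ⟨s, hs, rfl⟩, h3, h4⟩ := h
  refine ⟨d, u, y, _, rfl, h1, isL1Subgrad_of_le ht fun b => ?_, sub_eq_zero.2 h3, h4⟩
  have := mul_le_mul_of_nonneg_left (hs (u + b)) ht.le
  rwa [add_sub_cancel_left, mul_add, ← real_inner_smul_left] at this

/-- A KKT point gives a saddle point of the Lagrangian, strongly in `d`. -/
theorem IsKKT.lagrangian_ge {ds : Vec n} {us : Vec p} {ys : ℝ} {zs : Vec p}
    (h : IsKKT Y x t ds us ys zs) (d : Vec n) (u : Vec p) :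
    1 / 2 * ‖ds‖ ^ 2 + t * l1 us + 1 / 2 * ‖d - ds‖ ^ 2 ≤
      1 / 2 * ‖d‖ ^ 2 + t * l1 u + ys * inner ℝ d x + inner ℝ zs (residual Y x d u) := by
  have h1 := h.subgrad.le u
  have h2 : inner ℝ (ds + ys • x + mulVec Y zs) (d - ds) = 0 := by
    rw [h.stationary, inner_zero_left]
  have h3 : residual Y x d u = mulVec Y.transpose (d - ds) - (u - us) := by
    rw [← sub_zero (residual Y x d u), ← h.residual_eq, mulVec_sub]
    simp only [residual]
    abel
  have h4 : ‖d‖ ^ 2 = ‖ds‖ ^ 2 + 2 * inner ℝ ds (d - ds) + ‖d - ds‖ ^ 2 := by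
    rw [← norm_add_sq_real, add_sub_cancel]
  have h5 : inner ℝ x (d - ds) = inner ℝ d x := by
    rw [inner_sub_right, real_inner_comm, real_inner_comm ds x, h.orth, sub_zero]
  rw [inner_add_left, inner_add_left, real_inner_smul_left, inner_mulVec, h5] at h2
  rw [h3, inner_sub_right]
  linarith

theorem IsKKT.isOptimal {ds : Vec n} {us : Vec p} {ys : ℝ} {zs : Vec p}
    (h : IsKKT Y x t ds us ys zs) : IsOptimal Y x t (primalPt ds us) := by
  refine ⟨⟨h.feasible_eq, h.orth⟩, fun w hw => ?_⟩
  have h1 := h.lagrangian_ge w.fst w.snd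
  rw [hw.2, residual, hw.1, sub_self, inner_zero_right] at h1
  simp only [objective, Set.mem_ofPred_eq, primalPt_fst, primalPt_snd]
  nlinarith [sq_nonneg ‖w.fst - ds‖]

/-- The quadratic surplus in the saddle inequality leaves no room for a different `d` at equal
objective value, and feasibility then determines `u`. -/
theorem IsKKT.eq_of_isOptimal {ds : Vec n} {us : Vec p} {ys : ℝ} {zs : Vec p}
    (h : IsKKT Y x t ds us ys zs) {w : Primal n p} (hw : IsOptimal Y x t w) :
    w = primalPt ds us := by
  have h1 := h.lagrangian_ge w.fst w.snd
  have h2 : objective t w ≤ objective t (primalPt ds us) := hw.2 h.isOptimal.1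
  rw [hw.1.2, residual, hw.1.1, sub_self, inner_zero_right] at h1
  simp only [objective, primalPt_fst, primalPt_snd] at h2
  have h3 : ‖w.fst - ds‖ ^ 2 = 0 := le_antisymm (by linarith) (sq_nonneg _)
  have h4 : w.fst = ds := by
    rwa [sq_eq_zero_iff, norm_eq_zero, sub_eq_zero] at h3
  have h5 : w.snd = us := by
    rw [← hw.1.1, h4, h.feasible_eq]
  rw [primalPt, ← h4, ← h5]
  rfl

/-- The dual of the problem has a solution, hence there is a KKT point. -/
theorem exists_isKKT (Y : Matrix (Fin n) (Fin p) ℝ) {x : Vec n} (hx : ‖x‖ = 1) {t : ℝ}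
    (ht : 0 < t) : ∃ d u y z, IsKKT Y x t d u y z := by
  -- The minimizer in `d` of the Lagrangian after `y` has been eliminated: the projection of `-Yz`
  -- onto the orthogonal complement of `x`.
  let D : Vec p → Vec n := fun z => inner ℝ x (mulVec Y z) • x - mulVec Y z
  let c : Vec p := mulVec Y.transpose x
  have hDc : Continuous D := by
    have := continuous_mulVec Y
    fun_prop
  have hD : ∀ (z : Vec p) (s : ℝ) (h : Vec p), D (z + s • h) = D z + s • D h := by
    intro z s h
    simp only [D, mulVec_add, mulVec_smul, inner_add_right, real_inner_smul_right, add_smul,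
      mul_smul, smul_sub]
    abel
  have hDx : ∀ z, inner ℝ (D z) x = 0 := by
    intro z
    simp only [D, inner_sub_left, real_inner_smul_left, real_inner_self_eq_norm_sq, hx]
    rw [real_inner_comm]
    ring
  let box : Set (Vec p) := {z | ∀ i, |z i| ≤ t}
  have hbox : IsCompact box := by
    refine Metric.isCompact_of_isClosed_isBounded ?_ ?_
    · have : box = ⋂ i, {z : Vec p | |z i| ≤ t} := by ext; simp [box]
      rw [this]
      exact isClosed_iInter fun i => isClosed_le (by fun_prop) continuous_const
    · rw [isBounded_iff_forall_norm_le]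
      refine ⟨∑ _i : Fin p, t, fun z hz => (norm_le_l1 z).trans ?_⟩
      exact Finset.sum_le_sum fun i _ => hz i
  -- The function minimized is the negative of the dual objective, with `y` eliminated.
  obtain ⟨z, hz, hmin⟩ := hbox.exists_isMinOn (f := fun z => 1 / 2 * ‖D z‖ ^ 2 - inner ℝ c z)
    ⟨0, fun i => by simpa using ht.le⟩ (by fun_prop)
  have hconv : ∀ v ∈ box, ∀ s : ℝ, 0 ≤ s → s ≤ 1 → z + s • (v - z) ∈ box := by
    intro v hv s h0 h1 i
    have : (z + s • (v - z)) i = (1 - s) * z i + s * v i := by simp; ring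
    rw [this]
    refine (abs_add_le _ _).trans ?_
    rw [abs_mul, abs_mul, abs_of_nonneg h0, abs_of_nonneg (sub_nonneg.2 h1)]
    nlinarith [hz i, hv i]
  let u : Vec p := mulVec Y.transpose (D z) + c
  have hvar : ∀ v ∈ box, inner ℝ u (v - z) ≤ 0 := by
    intro v hv
    set h := v - z with hh
    have hkey : inner ℝ (D z) (D h) - inner ℝ c h = - inner ℝ u h := by
      have h1 : inner ℝ (D z) (D h) = - inner ℝ (D z) (mulVec Y h) := by
        simp only [D, inner_sub_right, real_inner_smul_right]
        have := hDx z
        simp only [D] at this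
        rw [this]
        ring
      rw [h1, real_inner_comm, inner_mulVec, real_inner_comm]
      simp only [u, inner_add_left]
      ring
    by_contra! hpos
    set q := inner ℝ u h with hq
    have hC : 0 < ‖D h‖ ^ 2 + q := by positivity
    -- A step short enough for the linear decrease `q` to beat the quadratic term; the `q` in the
    -- denominator keeps `s ≤ 1` and covers `D h = 0`.
    set s : ℝ := q / (‖D h‖ ^ 2 + q) with hs
    have hs0 : 0 < s := by positivity
    have hs1 : s ≤ 1 := by
      rw [hs, div_le_one hC]
      nlinarith [sq_nonneg ‖D h‖]
    have hm := hmin (hconv v hv s hs0.le hs1)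
    simp only [Set.mem_ofPred_eq, ← hh, hD, inner_add_right, real_inner_smul_right,
      norm_add_sq_real, norm_smul, mul_pow, Real.norm_eq_abs, sq_abs] at hm
    have h3 : s * (‖D h‖ ^ 2 + q) = q := div_mul_cancel₀ _ hC.ne'
    have h4 : 0 ≤ s * (-q + 1 / 2 * (s * ‖D h‖ ^ 2)) := by
      rw [← hkey]
      linarith
    have h5 := nonneg_of_mul_nonneg_right h4 hs0
    have h6 := mul_pos hs0 hpos
    linarith
  refine ⟨D z, u, -inner ℝ x (mulVec Y z), z, ?_, fun i => ⟨hz i, ?_⟩, ?_, hDx z⟩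
  · simp only [D, neg_smul]
    abel
  -- Changing only coordinate `i` of `z` to that of a subgradient at `u` stays in the box and yields
  -- complementarity.
  · obtain ⟨e, he⟩ := exists_isL1Subgrad ht u
    have h1 := hvar (z + EuclideanSpace.single i (e i - z i)) (by
      intro j
      by_cases hj : j = i
      · subst hj
        simpa using (he j).1
      · simpa [hj] using hz j)
    rw [add_sub_cancel_left, EuclideanSpace.inner_single_right] at h1
    simp only [conj_trivial] at h1
    have h2 : z i * u i ≤ t * |u i| := by
      refine (le_abs_self _).trans ?_
      rw [abs_mul]
      exact mul_le_mul_of_nonneg_right (hz i) (abs_nonneg _)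
    have h3 := (he i).2
    exact le_antisymm h2 (by linarith)
  · simp [residual, u, c]

end Problem
end ManPPA

/-! ### The augmented Lagrangian: one-step decrease and subdifferential -/

namespace ManPPA
section Problem

variable {n p : ℕ} {Y : Matrix (Fin n) (Fin p) ℝ} {x : Vec n} {t : ℝ}

theorem residual_add (d a : Vec n) (u b : Vec p) :
    residual Y x (d + a) (u + b) = residual Y x d u + (mulVec Y.transpose a - b) := by
  simp only [residual, mulVec_add]
  abel

/-- Completing the square absorbs the multiplier difference into the penalty. Without this bound the
real infimum `PsiStar` would be a default value and not a lower bound. -/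
theorem IsKKT.bddBelow_augLagrangian {ds : Vec n} {us : Vec p} {ys : ℝ} {zs : Vec p}
    (h : IsKKT Y x t ds us ys zs) {s : ℝ} (hs : 0 < s) (y : ℝ) (z : Vec p) :
    BddBelow (Set.range fun w => augLagrangian Y x t s w y z) := by
  refine ⟨1 / 2 * ‖ds‖ ^ 2 + t * l1 us - ((y - ys) ^ 2 + ‖z - zs‖ ^ 2) / (2 * s), ?_⟩
  rintro _ ⟨w, rfl⟩
  have h1 := h.lagrangian_ge w.fst w.snd
  simp only [augLagrangian]
  set q := inner ℝ w.fst x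
  set r := residual Y x w.fst w.snd
  have h2 : inner ℝ z r = inner ℝ zs r + inner ℝ (z - zs) r := by rw [inner_sub_left]; ring
  have h3 := sq_nonneg ‖(z - zs) + s • r‖
  rw [norm_add_sq_real, norm_smul, real_inner_smul_right, mul_pow, Real.norm_eq_abs,
    sq_abs] at h3
  have h4 : 0 ≤ ((y - ys) + s * q) ^ 2 := sq_nonneg _
  have h5 : -(((y - ys) ^ 2 + ‖z - zs‖ ^ 2) / (2 * s)) ≤
      (y - ys) * q + inner ℝ (z - zs) r + s / 2 * q ^ 2 + s / 2 * ‖r‖ ^ 2 := by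
    rw [← neg_div, div_le_iff₀ (by positivity)]
    nlinarith
  rw [h2]
  nlinarith [sq_nonneg ‖w.fst - ds‖]

/-- One inexact step of the augmented Lagrangian method, compared with a KKT point. -/
theorem IsKKT.step_le {ds : Vec n} {us : Vec p} {ys : ℝ} {zs : Vec p}
    (h : IsKKT Y x t ds us ys zs) (ht : 0 < t) {s : ℝ} (hs : 0 < s) {m e y : ℝ} {z : Vec p}
    (hm : ∀ w, m ≤ augLagrangian Y x t s w y z) {d : Vec n} {u : Vec p}
    (he : augLagrangian Y x t s (primalPt d u) y z - m ≤ e / (2 * s)) :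
    (y + s * inner ℝ d x - ys) ^ 2 + ‖z + s • residual Y x d u - zs‖ ^ 2
      + 1 / 2 * ((s * inner ℝ d x) ^ 2 + ‖s • residual Y x d u‖ ^ 2) + s * ‖d - ds‖ ^ 2
      ≤ (y - ys) ^ 2 + ‖z - zs‖ ^ 2 + 2 * e := by
  have h1 := h.lagrangian_ge d u
  -- Comparison with the midpoint towards the KKT point, where both constraint residuals are halved.
  -- A fraction 3/4 of the penalty thus survives, and this produces the extra `1/2` of the squared
  -- multiplier step.
  have hmid := hm (primalPt (ds + (1 / 2 : ℝ) • (d - ds)) (us + (1 / 2 : ℝ) • (u - us)))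
  have hl1 := l1_add_smul_le us (u - us) (s := 1 / 2) (by norm_num) (by norm_num)
  rw [add_sub_cancel] at hl1
  have hr : residual Y x (ds + (1 / 2 : ℝ) • (d - ds)) (us + (1 / 2 : ℝ) • (u - us)) =
      (1 / 2 : ℝ) • residual Y x d u := by
    have e1 := residual_add (Y := Y) (x := x) ds (d - ds) us (u - us)
    rw [add_sub_cancel, add_sub_cancel, h.residual_eq, zero_add] at e1
    rw [residual_add, h.residual_eq, zero_add, mulVec_smul, ← smul_sub, e1]
  have hq : inner ℝ (ds + (1 / 2 : ℝ) • (d - ds)) x = 1 / 2 * inner ℝ d x := by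
    rw [inner_add_left, real_inner_smul_left, inner_sub_left, h.orth]
    ring
  have hd : ‖ds + (1 / 2 : ℝ) • (d - ds)‖ ^ 2 =
      1 / 2 * ‖d‖ ^ 2 + 1 / 2 * ‖ds‖ ^ 2 - 1 / 4 * ‖d - ds‖ ^ 2 := by
    have h4 : ‖d‖ ^ 2 = ‖ds‖ ^ 2 + 2 * inner ℝ ds (d - ds) + ‖d - ds‖ ^ 2 := by
      rw [← norm_add_sq_real, add_sub_cancel]
    rw [norm_add_sq_real, real_inner_smul_right, norm_smul, mul_pow, h4]
    norm_num
    ring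
  simp only [augLagrangian, primalPt_fst, primalPt_snd] at he hmid
  rw [hr, hq, hd, real_inner_smul_right, norm_smul, mul_pow] at hmid
  norm_num at hmid
  have hl2 := mul_le_mul_of_nonneg_left hl1 ht.le
  set r := residual Y x d u
  set q := inner ℝ d x
  have he2 := (le_div_iff₀ (by positivity)).1 he
  have hz : ‖z + s • r - zs‖ ^ 2 =
      ‖z - zs‖ ^ 2 + 2 * (s * inner ℝ (z - zs) r) + s ^ 2 * ‖r‖ ^ 2 := by
    rw [show z + s • r - zs = (z - zs) + s • r by abel, norm_add_sq_real,
      real_inner_smul_right, norm_smul, mul_pow, Real.norm_eq_abs, sq_abs]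
  rw [hz, norm_smul, Real.norm_eq_abs, mul_pow |s| ‖r‖, sq_abs, inner_sub_left]
  have hfin : 0 ≤ 2 * (1 / 2 * (‖ds‖ ^ 2) * (1 / 2) + 1 / 4 * ‖d‖ ^ 2 - 1 / 8 * ‖d - ds‖ ^ 2
      + t * (1 / 2 * l1 us + 1 / 2 * l1 u) + 1 / 2 * (y * q) + 1 / 2 * inner ℝ z r
      + s / 8 * q ^ 2 + s / 8 * ‖r‖ ^ 2 - m) := by
    linarith
  have h1' := mul_le_mul_of_nonneg_left h1 hs.le
  have hfin' := mul_nonneg hs.le hfin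
  have hsd : 0 ≤ s * ‖d - ds‖ ^ 2 := by positivity
  linarith

/-- The exact second order expansion of the smooth part of the augmented Lagrangian. -/
theorem augLagrangian_add (s y : ℝ) (z : Vec p) (d a : Vec n) (u b : Vec p) :
    augLagrangian Y x t s (primalPt (d + a) (u + b)) y z =
      augLagrangian Y x t s (primalPt d u) y z + t * (l1 (u + b) - l1 u)
      + inner ℝ (d + (y + s * inner ℝ d x) • x + mulVec Y (z + s • residual Y x d u)) a
      - inner ℝ (z + s • residual Y x d u) b
      + (1 / 2 * ‖a‖ ^ 2 + s / 2 * (inner ℝ a x ^ 2 + ‖mulVec Y.transpose a - b‖ ^ 2)) := by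
  simp only [augLagrangian, primalPt_fst, primalPt_snd, residual_add]
  rw [norm_add_sq_real, norm_add_sq_real, inner_add_left (𝕜 := ℝ) d a x, inner_add_right,
    inner_add_left, inner_add_left, real_inner_smul_left, inner_mulVec, inner_sub_right,
    inner_sub_right, inner_add_left, inner_add_left, real_inner_smul_left, real_inner_smul_left,
    real_inner_comm a x]
  ring

/-- Along a ray the quadratic remainder is of second order, so only the gradient of the smooth part
counts, and it involves the updated multipliers. Subgradients in (C) therefore measure the KKT
residual of the new iterate. -/
theorem subdiff_augLagrangian {s y : ℝ} {z : Vec p} (ht : 0 < t) {d : Vec n} {u : Vec p}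
    {g : Primal n p}
    (hg : g ∈ subdiff (fun w => augLagrangian Y x t s w y z) (primalPt d u)) :
    g.fst = d + (y + s * inner ℝ d x) • x + mulVec Y (z + s • residual Y x d u) ∧
      IsL1Subgrad t u (g.snd + (z + s • residual Y x d u)) := by
  set yp := y + s * inner ℝ d x
  set zp := z + s • residual Y x d u
  have key : ∀ (a : Vec n) (b : Vec p), inner ℝ g.fst a + inner ℝ g.snd b ≤
      t * (l1 (u + b) - l1 u) + inner ℝ (d + yp • x + mulVec Y zp) a - inner ℝ zp b := by
    intro a b
    set C := 1 / 2 * ‖a‖ ^ 2 + s / 2 * (inner ℝ a x ^ 2 + ‖mulVec Y.transpose a - b‖ ^ 2) with hC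
    set P := inner ℝ g.fst a + inner ℝ g.snd b with hP
    set Q := t * (l1 (u + b) - l1 u) + inner ℝ (d + yp • x + mulVec Y zp) a - inner ℝ zp b
      with hQ
    have hsmall : ∀ r : ℝ, 0 < r → r ≤ 1 → P - Q ≤ r * C := by
      intro r hr0 hr1
      have h1 := hg (primalPt (d + r • a) (u + r • b))
      have h2 : inner ℝ g (primalPt (d + r • a) (u + r • b) - primalPt d u) = r * P := by
        rw [WithLp.prod_inner_apply]
        simp only [hP, primalPt, ← WithLp.toLp_sub, Prod.mk_sub_mk, add_sub_cancel_left,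
          real_inner_smul_right]
        change r * inner ℝ g.fst a + r * inner ℝ g.snd b = _
        ring
      have h3 := mul_le_mul_of_nonneg_left (l1_add_smul_le u b hr0.le hr1) ht.le
      simp only at h1
      rw [h2, augLagrangian_add, mulVec_smul, ← smul_sub, norm_smul, norm_smul,
        real_inner_smul_left, real_inner_smul_right, real_inner_smul_right, mul_pow, mul_pow,
        mul_pow, Real.norm_eq_abs, sq_abs] at h1
      refine le_of_mul_le_mul_left ?_ hr0
      simp only [hQ, hC]
      linarith
    by_contra! hlt
    have hpos : 0 < P - Q := by linarith
    have hD : 0 < |C| + (P - Q) := by positivity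
    -- With this step length the remainder is at most `(P - Q) / 2`, which replaces a passage to the
    -- limit.
    have hr : (P - Q) / (2 * (|C| + (P - Q))) ≤ 1 := by
      rw [div_le_one (by positivity)]
      linarith [abs_nonneg C]
    have h1 := hsmall ((P - Q) / (2 * (|C| + (P - Q)))) (by positivity) hr
    rw [div_mul_eq_mul_div, le_div_iff₀ (by positivity)] at h1
    nlinarith [le_abs_self C, abs_nonneg C, mul_le_mul_of_nonneg_left (le_abs_self C) hpos.le,
      mul_nonneg hpos.le (abs_nonneg C), mul_pos hpos hpos]
  constructor
  · have h1 := key (g.fst - (d + yp • x + mulVec Y zp)) 0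
    rw [inner_zero_right, inner_zero_right, add_zero (u : Vec p), sub_self, mul_zero] at h1
    have h2 : ‖g.fst - (d + yp • x + mulVec Y zp)‖ ^ 2 ≤ 0 := by
      rw [← real_inner_self_eq_norm_sq, inner_sub_left]
      linarith
    have h3 := le_antisymm h2 (sq_nonneg _)
    rwa [sq_eq_zero_iff, norm_eq_zero, sub_eq_zero] at h3
  · refine isL1Subgrad_of_le ht fun b => ?_
    have h1 := key 0 b
    rw [inner_zero_right, inner_zero_right] at h1
    rw [inner_add_left]
    linarith

/-- Needed because `Metric.infDist` to the empty set is zero, which would empty (C) of content. -/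
theorem subdiff_augLagrangian_nonempty {s : ℝ} (hs : 0 < s) (y : ℝ) (z : Vec p) (ht : 0 < t)
    (d : Vec n) (u : Vec p) :
    (subdiff (fun w => augLagrangian Y x t s w y z) (primalPt d u)).Nonempty := by
  obtain ⟨e, he⟩ := exists_isL1Subgrad ht u
  refine ⟨primalPt (d + (y + s * inner ℝ d x) • x + mulVec Y (z + s • residual Y x d u))
    (e - (z + s • residual Y x d u)), fun v => ?_⟩
  have h1 := augLagrangian_add (Y := Y) (x := x) (t := t) s y z d (v.fst - d) u (v.snd - u)
  have h2 := he.le v.snd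
  rw [add_sub_cancel, add_sub_cancel] at h1
  have h3 : primalPt v.fst v.snd = v := rfl
  rw [h3] at h1
  simp only
  rw [h1, WithLp.prod_inner_apply]
  change _ + (inner ℝ (d + (y + s * inner ℝ d x) • x + mulVec Y (z + s • residual Y x d u))
    (v.fst - d) + inner ℝ (e - (z + s • residual Y x d u)) (v.snd - u)) ≤ _
  have h4 : 0 ≤ 1 / 2 * ‖v.fst - d‖ ^ 2 + s / 2 * (inner ℝ (v.fst - d) x ^ 2
      + ‖mulVec Y.transpose (v.fst - d) - (v.snd - u)‖ ^ 2) := by positivity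
  rw [inner_sub_left]
  linarith

theorem isClosed_subdiff {E : Type*} [NormedAddCommGroup E] [InnerProductSpace ℝ E] (f : E → ℝ)
    (w : E) : IsClosed (subdiff f w) := by
  have : subdiff f w = ⋂ v, {g | f w + inner ℝ g (v - w) ≤ f v} := by
    ext g
    simp [subdiff]
  rw [this]
  exact isClosed_iInter fun v => isClosed_le (by fun_prop) continuous_const

end Problem
end ManPPA

/-! ### Error bounds for the KKT set -/

namespace ManPPA
section Problem

variable {n p : ℕ} {Y : Matrix (Fin n) (Fin p) ℝ} {x : Vec n} {t : ℝ}

/-- The multipliers of a KKT point form a polyhedron, which has Hoffman's error bound. -/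
theorem IsKKT.multiplier_error_bound {ds : Vec n} {us : Vec p} {ys : ℝ} {zs : Vec p}
    (h : IsKKT Y x t ds us ys zs) :
    ∃ κ : ℝ, 0 ≤ κ ∧ ∀ (y : ℝ) (z : Vec p) (e : ℝ), 0 ≤ e →
      ‖ds + y • x + mulVec Y z‖ ≤ e →
      (∀ i, |z i| ≤ t + e ∧ abs (z i * us i - t * |us i|) ≤ e) →
      ∃ y' z', IsKKT Y x t ds us y' z' ∧ |y - y'| + ‖z - z'‖ ≤ κ * e := by
  -- With `ds` and `us` fixed, stationarity, the box bounds and complementarity are all linear in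
  -- `(y, z)`; coordinate 0 holds `y`.
  let a : Fin n ⊕ (Fin p ⊕ Fin p) → Fin (p + 1) → ℝ :=
    Sum.elim (fun k => Fin.cons (x k) (Y k))
      (Sum.elim (fun i => Fin.cons 0 (Pi.single i 1)) (fun i => Fin.cons 0 (Pi.single i (us i))))
  let lo : Fin n ⊕ (Fin p ⊕ Fin p) → ℝ :=
    Sum.elim (fun k => -ds k) (Sum.elim (fun _ => -t) (fun i => t * |us i|))
  let hi : Fin n ⊕ (Fin p ⊕ Fin p) → ℝ :=
    Sum.elim (fun k => -ds k) (Sum.elim (fun _ => t) (fun i => t * |us i|))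
  have ha1 : ∀ k (v : Fin (p + 1) → ℝ), a (.inl k) ⬝ᵥ v =
      (ds + v 0 • x + mulVec Y (WithLp.toLp 2 (Fin.tail v))) k - ds k := by
    intro k v
    rw [dotProduct_eq_head_add_tail]
    simp [a, mulVec, Matrix.mulVec, mul_comm]
    ring
  have ha2 : ∀ i (v : Fin (p + 1) → ℝ), a (.inr (.inl i)) ⬝ᵥ v = Fin.tail v i := by
    intro i v
    rw [dotProduct_eq_head_add_tail]
    simp [a]
  have ha3 : ∀ i (v : Fin (p + 1) → ℝ), a (.inr (.inr i)) ⬝ᵥ v = Fin.tail v i * us i := by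
    intro i v
    rw [dotProduct_eq_head_add_tail]
    simp [a, mul_comm]
  obtain ⟨κ, hκ, H⟩ := hoffman_two_sided a
  refine ⟨κ + p * κ, by positivity, fun y z e he h1 h2 => ?_⟩
  obtain ⟨v, hv, hd⟩ := H lo hi e he ⟨Fin.cons ys zs.ofLp, by
      rintro (k | i | i)
      · rw [ha1, Fin.cons_zero, Fin.tail_cons, WithLp.toLp_ofLp, h.stationary]
        simp [lo, hi]
      · rw [ha2, Fin.tail_cons]
        exact abs_le.1 (h.subgrad i).1
      · rw [ha3, Fin.tail_cons]
        exact ⟨(h.subgrad i).2.ge, (h.subgrad i).2.le⟩⟩ (Fin.cons y z.ofLp) (by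
      rintro (k | i | i)
      · rw [ha1, Fin.cons_zero, Fin.tail_cons, WithLp.toLp_ofLp]
        have := abs_le.1 ((abs_apply_le_norm _ k).trans h1)
        simp only [lo, hi, Sum.elim_inl]
        constructor <;> linarith
      · rw [ha2, Fin.tail_cons]
        have := abs_le.1 (h2 i).1
        simp only [lo, hi, Sum.elim_inl, Sum.elim_inr]
        constructor <;> linarith
      · rw [ha3, Fin.tail_cons]
        have := abs_le.1 (h2 i).2
        simp only [lo, hi, Sum.elim_inr]
        constructor <;> linarith)
  refine ⟨v 0, WithLp.toLp 2 (Fin.tail v), ⟨?_, fun i => ⟨?_, ?_⟩, h.residual_eq, h.orth⟩, ?_⟩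
  · ext k
    have := hv (.inl k)
    rw [ha1] at this
    simp only [lo, hi, Sum.elim_inl] at this
    rw [PiLp.zero_apply]
    linarith
  · have := hv (.inr (.inl i))
    rw [ha2] at this
    exact abs_le.2 this
  · have := hv (.inr (.inr i))
    rw [ha3] at this
    exact le_antisymm this.2 this.1
  · have h0 := hd 0
    rw [Fin.cons_zero] at h0
    have h3 : ‖z - WithLp.toLp 2 (Fin.tail v)‖ ≤ p * κ * e := by
      refine (norm_le_l1 _).trans ?_
      have : (p : ℝ) * κ * e = ∑ _i : Fin p, κ * e := by simp [mul_assoc]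
      rw [this]
      refine Finset.sum_le_sum fun i _ => ?_
      have := hd i.succ
      rwa [Fin.cons_succ] at this
    linarith

theorem dist_primalDualPt_sq (d d' : Vec n) (u u' : Vec p) (y y' : ℝ) (z z' : Vec p) :
    dist (primalDualPt d u y z) (primalDualPt d' u' y' z') ^ 2 =
      ‖d - d'‖ ^ 2 + ‖u - u'‖ ^ 2 + ((y - y') ^ 2 + ‖z - z'‖ ^ 2) := by
  rw [dist_eq_norm, WithLp.prod_norm_sq_eq_of_L2, WithLp.prod_norm_sq_eq_of_L2,
    WithLp.prod_norm_sq_eq_of_L2]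
  change ‖d - d'‖ ^ 2 + ‖u - u'‖ ^ 2 + (‖y - y'‖ ^ 2 + ‖z - z'‖ ^ 2) = _
  rw [Real.norm_eq_abs, sq_abs]

theorem dist_primalDualPt_le (d d' : Vec n) (u u' : Vec p) (y y' : ℝ) (z z' : Vec p) :
    dist (primalDualPt d u y z) (primalDualPt d' u' y' z') ≤
      ‖d - d'‖ + ‖u - u'‖ + (|y - y'| + ‖z - z'‖) := by
  rw [← sq_le_sq₀ dist_nonneg (by positivity), dist_primalDualPt_sq, ← sq_abs (y - y')]
  have h1 := norm_nonneg (d - d')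
  have h2 := norm_nonneg (u - u')
  have h3 := abs_nonneg (y - y')
  have h4 := norm_nonneg (z - z')
  nlinarith [mul_nonneg h1 h2, mul_nonneg h3 h4, mul_nonneg (add_nonneg h1 h2) (add_nonneg h3 h4)]

/-- Strong monotonicity in `d` of the KKT operator. -/
theorem IsKKT.sq_norm_sub_le {ds : Vec n} {us : Vec p} {ys : ℝ} {zs : Vec p}
    (h : IsKKT Y x t ds us ys zs) {d : Vec n} {u : Vec p} {y : ℝ} {z g : Vec p}
    (hg : IsL1Subgrad t u (g + z)) :
    ‖d - ds‖ ^ 2 ≤ (‖d + y • x + mulVec Y z‖ + ‖g‖ + |inner ℝ d x| + ‖residual Y x d u‖) *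
      (‖d - ds‖ + ‖u - us‖ + (|y - ys| + ‖z - zs‖)) := by
  set f := d + y • x + mulVec Y z with hf
  set r := residual Y x d u with hr
  have h1 := hg.le us
  have h2 := h.subgrad.le u
  have h3 : d - ds = f - (y - ys) • x - mulVec Y (z - zs) := by
    rw [← sub_zero f, ← h.stationary, hf, mulVec_sub, sub_smul]
    abel
  have h4 : mulVec Y.transpose (d - ds) = r + (u - us) := by
    rw [← sub_zero r, ← h.residual_eq, hr, mulVec_sub]
    simp only [residual]
    abel
  have h5 : inner ℝ x (d - ds) = inner ℝ d x := by
    rw [inner_sub_right, real_inner_comm, real_inner_comm ds x, h.orth, sub_zero]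
  have h6 : ‖d - ds‖ ^ 2 = inner ℝ f (d - ds) - (y - ys) * inner ℝ d x
      - inner ℝ (z - zs) r - inner ℝ (z - zs) (u - us) := by
    rw [← real_inner_self_eq_norm_sq]
    nth_rewrite 1 [h3]
    rw [inner_sub_left, inner_sub_left, real_inner_smul_left, inner_mulVec, h4, h5,
      inner_add_right]
    ring
  have h7 : inner ℝ (g + z) (us - u) = - inner ℝ g (u - us) - inner ℝ z (u - us) := by
    rw [← neg_sub u us, inner_neg_right, inner_add_left]
    ring
  have h8 : ‖d - ds‖ ^ 2 ≤ inner ℝ f (d - ds) - (y - ys) * inner ℝ d x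
      -- Adding `h1` and `h2` is the monotonicity of the ℓ₁ subdifferential.
      - inner ℝ (z - zs) r + inner ℝ g (u - us) := by
    rw [h6, inner_sub_left (z) zs (u - us)]
    linarith
  have b1 := real_inner_le_norm f (d - ds)
  have b2 : -((y - ys) * inner ℝ d x) ≤ |y - ys| * |inner ℝ d x| := by
    rw [← abs_mul]
    exact neg_le_abs _
  have b3 : -inner ℝ (z - zs) r ≤ ‖z - zs‖ * ‖r‖ :=
    (neg_le_abs _).trans (abs_real_inner_le_norm _ _)
  have b4 := real_inner_le_norm g (u - us)
  have n1 := norm_nonneg f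
  have n2 := norm_nonneg g
  have n3 := abs_nonneg (inner ℝ d x)
  have n4 := norm_nonneg r
  have m1 := norm_nonneg (d - ds)
  have m2 := norm_nonneg (u - us)
  have m3 := abs_nonneg (y - ys)
  have m4 := norm_nonneg (z - zs)
  have t1 : ‖f‖ * (‖u - us‖ + (|y - ys| + ‖z - zs‖)) ≥ 0 := by positivity
  have t2 : ‖g‖ * (‖d - ds‖ + (|y - ys| + ‖z - zs‖)) ≥ 0 := by positivity
  have t3 : |inner ℝ d x| * (‖d - ds‖ + ‖u - us‖ + ‖z - zs‖) ≥ 0 := by positivity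
  have t4 : ‖r‖ * (‖d - ds‖ + ‖u - us‖ + |y - ys|) ≥ 0 := by positivity
  linarith

theorem le_of_sq_le_mul_add {e R C : ℝ} (hR : 0 ≤ R) (hC : 0 ≤ C)
    (h : e ^ 2 ≤ R * (C * (e + R))) : e ≤ (C + 1) * R := by
  by_contra! hlt
  have h0 : 0 < e := lt_of_le_of_lt (by positivity) hlt
  nlinarith [mul_lt_mul_of_pos_right hlt h0, mul_nonneg hR hC, mul_nonneg hR hR,
    mul_le_mul_of_nonneg_left hlt.le hR]

/-- Stability of the nonzero signs, by which complementarity at a nearby `u` carries over to `us`.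
-/
theorem eventually_forall_mul_pos {p : ℕ} (us : Vec p) :
    ∀ᶠ u in 𝓝 us, ∀ i, us i ≠ 0 → 0 < u i * us i := by
  rw [eventually_all]
  intro i
  by_cases hi : us i = 0
  · exact Eventually.of_forall fun u h => absurd hi h
  · have hc : ContinuousAt (fun u : Vec p => u i * us i) us := by fun_prop
    filter_upwards [hc.eventually (lt_mem_nhds (mul_self_pos.2 hi))] with u hu _ using hu

/-- Local error bound for the KKT system in terms of the KKT residual. -/
theorem IsKKT.error_bound {ds : Vec n} {us : Vec p} {ys : ℝ} {zs : Vec p} (ht : 0 < t)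
    (h : IsKKT Y x t ds us ys zs) :
    ∃ C : ℝ, 0 ≤ C ∧ ∀ᶠ u in 𝓝 us, ∀ (d : Vec n) (y : ℝ) (z g : Vec p),
      IsL1Subgrad t u (g + z) →
      Metric.infDist (primalDualPt d u y z) (kktSet Y x t) ≤
        C * (‖d + y • x + mulVec Y z‖ + ‖g‖ + |inner ℝ d x| + ‖residual Y x d u‖) := by
  obtain ⟨κ, hκ, H⟩ := h.multiplier_error_bound
  obtain ⟨A, hA, hAle⟩ := exists_norm_mulVec_le Y.transpose
  set C := 2 + A + κ * (2 + ‖us‖) with hC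
  have hC0 : 0 ≤ C := by positivity
  refine ⟨C * (C + 2), by positivity, ?_⟩
  filter_upwards [eventually_forall_mul_pos us] with u hu d y z g hg
  set f := d + y • x + mulVec Y z with hf
  set r := residual Y x d u with hr
  set R := ‖f‖ + ‖g‖ + |inner ℝ d x| + ‖r‖ with hR
  have hR0 : 0 ≤ R := by positivity
  have n1 := norm_nonneg f
  have n2 := norm_nonneg g
  have n3 := abs_nonneg (inner ℝ d x)
  have n4 := norm_nonneg r
  have nu := norm_nonneg us
  have nd := norm_nonneg (d - ds)
  -- The tolerance bounds the violation by `(y, z)` of the multiplier system at `(ds, us)`: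
  -- replacing `d` by `ds` costs `‖d - ds‖`, and removing `g` costs at most `‖g‖` or `‖g‖ * ‖us‖`.
  obtain ⟨y', z', hk, hyz⟩ := H y z (‖d - ds‖ + (1 + ‖us‖) * R) (by positivity) (by
      have e1 : ds + y • x + mulVec Y z = f - (d - ds) := by rw [hf]; abel
      rw [e1]
      refine (norm_sub_le _ _).trans ?_
      nlinarith [mul_nonneg nu hR0]) (by
      intro i
      have hgi := abs_apply_le_norm g i
      have e1 : z i = (g + z) i - g i := by simp
      have hmul := mul_nonneg nu hR0
      have hgR : ‖g‖ ≤ R := by linarith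
      constructor
      · rw [e1]
        refine (abs_sub _ _).trans ?_
        have := (hg i).1
        linarith
      · by_cases hi : us i = 0
        · rw [hi]
          simp only [mul_zero, abs_zero, sub_zero]
          positivity
        · have e2 := hg.mul_eq_of_pos (hu i hi)
          rw [e1, sub_mul, e2, sub_sub_cancel_left, abs_neg, abs_mul]
          have := mul_le_mul (hgi.trans hgR) (abs_apply_le_norm us i) (abs_nonneg _) hR0
          linarith)
  have hu' : ‖u - us‖ ≤ A * ‖d - ds‖ + R := by
    have e1 : u - us = mulVec Y.transpose (d - ds) - r := by
      rw [← sub_zero r, ← h.residual_eq, hr, mulVec_sub]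
      simp only [residual]
      abel
    rw [e1]
    refine (norm_sub_le _ _).trans ?_
    linarith [hAle (d - ds)]
  have hD : ‖d - ds‖ + ‖u - us‖ + (|y - y'| + ‖z - z'‖) ≤ C * (‖d - ds‖ + R) := by
    have p1 := mul_nonneg hκ nd
    have p2 := mul_nonneg (mul_nonneg hκ nu) nd
    have p3 := mul_nonneg hA hR0
    have p4 := mul_nonneg hκ hR0
    rw [hC]
    linarith
  -- Monotonicity is used at the nearby multipliers `(y', z')`, so its right side involves only `‖d
  -- - ds‖` and `R`, and the bound is uniform in `y` and `z`.
  have hmon := hk.sq_norm_sub_le (d := d) (y := y) hg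
  have he : ‖d - ds‖ ≤ (C + 1) * R :=
    le_of_sq_le_mul_add hR0 hC0 (hmon.trans (mul_le_mul_of_nonneg_left hD hR0))
  refine (Metric.infDist_le_dist_of_mem (hk.mem ht)).trans ?_
  refine (dist_primalDualPt_le _ _ _ _ _ _ _ _).trans (hD.trans ?_)
  rw [mul_assoc]
  exact mul_le_mul_of_nonneg_left (by linarith) hC0

end Problem
end ManPPA

/-! ### Convergence of the iterates and the rate estimates -/

namespace ManPPA

/-- The decrements of a quasi-Fejér sequence tend to zero. -/
theorem tendsto_zero_of_quasiFejer {a b c : ℕ → ℝ} (ha : ∀ j, 0 ≤ a j) (hb : ∀ j, 0 ≤ b j) (hc : ∀ j, 0 ≤ c j)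
    (hs : Summable c) (h : ∀ j, a (j + 1) + b j ≤ a j + c j) : Tendsto b atTop (𝓝 0) := by
  refine Summable.tendsto_atTop_zero (summable_of_sum_range_le (c := a 0 + ∑' j, c j) hb
    fun N => ?_)
  have key : ∀ N, a N + ∑ j ∈ Finset.range N, b j ≤ a 0 + ∑ j ∈ Finset.range N, c j := by
    intro N
    induction N with
    | zero => simp
    | succ N ih =>
      rw [Finset.sum_range_succ, Finset.sum_range_succ]
      linarith [h N]
  linarith [key N, ha N, hs.sum_le_tsum (Finset.range N) fun j _ => hc j]

theorem summable_sq_of_nonneg {e : ℕ → ℝ} (h0 : ∀ j, 0 ≤ e j) (h : Summable e) :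
    Summable fun j => e j ^ 2 := by
  refine Summable.of_norm_bounded_eventually_nat h ?_
  filter_upwards [h.tendsto_atTop_zero.eventually (gt_mem_nhds one_pos)] with j hj
  rw [Real.norm_eq_abs, abs_of_nonneg (sq_nonneg _)]
  nlinarith [h0 j]

theorem tendsto_zero_of_sq {b : ℕ → ℝ} (h : Tendsto (fun j => b j ^ 2) atTop (𝓝 0)) :
    Tendsto b atTop (𝓝 0) := by
  have := h.sqrt
  simp only [Real.sqrt_sq_eq_abs, Real.sqrt_zero] at this
  exact (tendsto_zero_iff_abs_tendsto_zero _).2 this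

section Problem

variable {n p : ℕ} {Y : Matrix (Fin n) (Fin p) ℝ} {x : Vec n} {t : ℝ}
  {σ : ℕ → ℝ} {d : ℕ → Vec n} {u : ℕ → Vec p} {y : ℕ → ℝ} {z : ℕ → Vec p}

/-- The length `Δ_j` of the multiplier update in step `j`. -/
noncomputable def multiplierStep (y : ℕ → ℝ) (z : ℕ → Vec p) (j : ℕ) : ℝ :=
  ‖dualPt (y (j + 1)) (z (j + 1)) - dualPt (y j) (z j)‖

theorem multiplierStep_sq (hALM : IsInexactALM Y x σ d u y z) (j : ℕ) :
    multiplierStep y z j ^ 2 =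
      (σ j * inner ℝ (d (j + 1)) x) ^ 2 + ‖σ j • residual Y x (d (j + 1)) (u (j + 1))‖ ^ 2 := by
  rw [multiplierStep, WithLp.prod_norm_sq_eq_of_L2]
  change ‖y (j + 1) - y j‖ ^ 2 + ‖z (j + 1) - z j‖ ^ 2 = _
  rw [hALM.y_update, hALM.z_update, add_sub_cancel_left, add_sub_cancel_left, Real.norm_eq_abs,
    sq_abs]

theorem multiplierStep_nonneg (y : ℕ → ℝ) (z : ℕ → Vec p) (j : ℕ) : 0 ≤ multiplierStep y z j :=
  norm_nonneg _

/-- The allowance `e` is left free to serve both (A), with `ε j ^ 2`, and (B), with `δ j ^ 2` times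
the squared multiplier step. -/
theorem IsKKT.alm_step {ds : Vec n} {us : Vec p} {ys : ℝ} {zs : Vec p}
    (h : IsKKT Y x t ds us ys zs) (ht : 0 < t) (hALM : IsInexactALM Y x σ d u y z) {j : ℕ} {e : ℝ}
    (he : Psi Y x t σ y z j (primalPt (d (j + 1)) (u (j + 1))) - PsiStar Y x t σ y z j
      ≤ e / (2 * σ j)) :
    (y (j + 1) - ys) ^ 2 + ‖z (j + 1) - zs‖ ^ 2
      + (1 / 2 * multiplierStep y z j ^ 2 + σ j * ‖d (j + 1) - ds‖ ^ 2)
      ≤ (y j - ys) ^ 2 + ‖z j - zs‖ ^ 2 + 2 * e := by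
  rw [multiplierStep_sq hALM, hALM.y_update, hALM.z_update, ← add_assoc]
  exact h.step_le ht (hALM.sigma_pos j)
    (fun w => ciInf_le (h.bddBelow_augLagrangian (hALM.sigma_pos j) (y j) (z j)) w) he

/-- The vanishing decrements control Δ_j and, as σ_j ≥ σ_0 > 0, the error in `d`. The residual is at
most Δ_j/σ_0, so `u` follows from the constraint. -/
theorem IsKKT.tendsto_alm {ds : Vec n} {us : Vec p} {ys : ℝ} {zs : Vec p}
    (h : IsKKT Y x t ds us ys zs) (ht : 0 < t) (hALM : IsInexactALM Y x σ d u y z) {ε : ℕ → ℝ}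
    (hA : CriterionA Y x t σ d u y z ε) :
    Tendsto (multiplierStep y z) atTop (𝓝 0) ∧ Tendsto d atTop (𝓝 ds) ∧
      Tendsto u atTop (𝓝 us) := by
  have hb := tendsto_zero_of_quasiFejer (a := fun j => (y j - ys) ^ 2 + ‖z j - zs‖ ^ 2)
    (b := fun j => 1 / 2 * multiplierStep y z j ^ 2 + σ j * ‖d (j + 1) - ds‖ ^ 2)
    (c := fun j => 2 * ε j ^ 2) (fun j => by positivity)
    (fun j => by have := hALM.sigma_pos j; positivity) (fun j => by positivity)
    ((summable_sq_of_nonneg hA.nonneg hA.summable).mul_left 2)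
    (fun j => h.alm_step ht hALM (hA.le j))
  have h0 := hALM.sigma_pos 0
  have hσ : ∀ j, σ 0 ≤ σ j := fun j => hALM.sigma_mono (Nat.zero_le j)
  have hstep : Tendsto (multiplierStep y z) atTop (𝓝 0) := by
    refine tendsto_zero_of_sq (squeeze_zero (fun j => sq_nonneg _) (fun j => ?_)
      (by simpa using hb.const_mul 2))
    have : 0 ≤ σ j * ‖d (j + 1) - ds‖ ^ 2 := by have := hALM.sigma_pos j; positivity
    linarith
  have hd1 : Tendsto (fun j => d (j + 1)) atTop (𝓝 ds) := by
    rw [tendsto_iff_norm_sub_tendsto_zero]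
    refine tendsto_zero_of_sq (squeeze_zero (fun j => sq_nonneg _) (fun j => ?_)
      (by simpa using hb.const_mul (σ 0)⁻¹))
    rw [le_inv_mul_iff₀ h0]
    have := mul_le_mul_of_nonneg_right (hσ j) (sq_nonneg ‖d (j + 1) - ds‖)
    nlinarith [sq_nonneg (multiplierStep y z j)]
  have hr : Tendsto (fun j => residual Y x (d (j + 1)) (u (j + 1))) atTop (𝓝 0) := by
    rw [tendsto_zero_iff_norm_tendsto_zero]
    refine squeeze_zero (fun j => norm_nonneg _) (fun j => ?_)
      (by simpa using hstep.const_mul (σ 0)⁻¹)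
    rw [le_inv_mul_iff₀ h0]
    refine (mul_le_mul_of_nonneg_right (hσ j) (norm_nonneg _)).trans ?_
    rw [← sq_le_sq₀ (by have := hALM.sigma_pos j; positivity) (multiplierStep_nonneg y z j),
      multiplierStep_sq hALM, norm_smul, Real.norm_eq_abs, abs_of_pos (hALM.sigma_pos j)]
    exact le_add_of_nonneg_left (sq_nonneg _)
  have hu1 : Tendsto (fun j => u (j + 1)) atTop (𝓝 us) := by
    have h1 := (((continuous_mulVec Y.transpose).tendsto ds).comp hd1).add_const
      (mulVec Y.transpose x) |>.sub hr
    rw [h.feasible_eq, sub_zero] at h1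
    refine h1.congr fun j => ?_
    simp only [residual, Function.comp_apply]
    abel
  exact ⟨hstep, (tendsto_add_atTop_iff_nat 1).1 hd1, (tendsto_add_atTop_iff_nat 1).1 hu1⟩

/-- Under criterion (B), the multiplier step is bounded by the distance to the KKT set. -/
theorem multiplierStep_le_infDist (ht : 0 < t) (hne : (kktSet Y x t).Nonempty)
    (hALM : IsInexactALM Y x σ d u y z) {δ : ℕ → ℝ} (hB : CriterionB Y x t σ d u y z δ) :
    ∀ᶠ j in atTop, multiplierStep y z j ≤
      2 * Metric.infDist (primalDualPt (d j) (u j) (y j) (z j)) (kktSet Y x t) := by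
  -- Once `δ j ^ 2 < 1/8`, the allowance is at most half of the gained `Δ_j²/2`; the other half
  -- gives `Δ_j ≤ 2 dist` for every KKT point.
  filter_upwards [(summable_sq_of_nonneg hB.nonneg hB.summable).tendsto_atTop_zero.eventually
    (gt_mem_nhds (show (0 : ℝ) < 1 / 8 by norm_num))] with j hj
  rw [← div_le_iff₀' two_pos, Metric.le_infDist hne]
  intro w hw
  obtain ⟨ds, us, ys, zs, rfl, h⟩ := exists_isKKT_of_mem ht hw
  have h1 := h.alm_step ht hALM (j := j) (e := δ j ^ 2 * multiplierStep y z j ^ 2) (by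
    have := hB.le j
    rwa [div_mul_eq_mul_div] at this)
  have h2 : 0 ≤ σ j * ‖d (j + 1) - ds‖ ^ 2 := by have := hALM.sigma_pos j; positivity
  have h3 := multiplierStep_nonneg y z j
  rw [← sq_le_sq₀ (by positivity) dist_nonneg, dist_primalDualPt_sq]
  have h4 := mul_le_mul_of_nonneg_right hj.le (sq_nonneg (multiplierStep y z j))
  nlinarith [sq_nonneg (y (j + 1) - ys), sq_nonneg ‖z (j + 1) - zs‖, sq_nonneg ‖d j - ds‖,
    sq_nonneg ‖u j - us‖]

/-- Under criterion (C), the KKT error of the new iterate is bounded by the multiplier step. -/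
theorem IsKKT.infDist_succ_le {ds : Vec n} {us : Vec p} {ys : ℝ} {zs : Vec p}
    (h : IsKKT Y x t ds us ys zs) (ht : 0 < t) (hALM : IsInexactALM Y x σ d u y z) {δ' : ℕ → ℝ}
    (hC : CriterionC Y x t σ d u y z δ') (hu : Tendsto u atTop (𝓝 us)) :
    ∃ C : ℝ, 0 ≤ C ∧ ∀ᶠ j in atTop,
      Metric.infDist (primalDualPt (d (j + 1)) (u (j + 1)) (y (j + 1)) (z (j + 1)))
        (kktSet Y x t) ≤ C * ((δ' j + 1) / σ j) * multiplierStep y z j := by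
  obtain ⟨C, hC0, hev⟩ := h.error_bound ht
  -- Two residual terms come from the subgradient, each at most `δ' j / σ j` times Δ_j, and two from
  -- the constraints, each at most Δ_j/σ_j.
  refine ⟨C * 2, by positivity, ?_⟩
  filter_upwards [((tendsto_add_atTop_iff_nat 1).2 hu).eventually hev] with j hj
  have hσ := hALM.sigma_pos j
  have hm0 := multiplierStep_nonneg y z j
  obtain ⟨g, hg, hdist⟩ := (isClosed_subdiff (Psi Y x t σ y z j)
    (primalPt (d (j + 1)) (u (j + 1)))).exists_infDist_eq_dist
    (subdiff_augLagrangian_nonempty hσ (y j) (z j) ht _ _) 0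
  obtain ⟨g1, g2⟩ := subdiff_augLagrangian ht hg
  rw [← hALM.y_update, ← hALM.z_update] at g1
  rw [← hALM.z_update] at g2
  have hgn : ‖g‖ ≤ δ' j / σ j * multiplierStep y z j := by
    have := hC.le j
    rwa [hdist, dist_zero_left] at this
  have hg1 : ‖g.fst‖ ≤ ‖g‖ := by
    rw [← sq_le_sq₀ (norm_nonneg _) (norm_nonneg _), WithLp.prod_norm_sq_eq_of_L2]
    exact le_add_of_nonneg_right (sq_nonneg _)
  have hg2 : ‖g.snd‖ ≤ ‖g‖ := by
    rw [← sq_le_sq₀ (norm_nonneg _) (norm_nonneg _), WithLp.prod_norm_sq_eq_of_L2]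
    exact le_add_of_nonneg_left (sq_nonneg _)
  have hsq := multiplierStep_sq hALM j
  have hq : |inner ℝ (d (j + 1)) x| ≤ 1 / σ j * multiplierStep y z j := by
    rw [div_mul_eq_mul_div, one_mul, le_div_iff₀' hσ, ← abs_of_pos hσ, ← abs_mul,
      ← sq_le_sq₀ (abs_nonneg _) hm0, hsq, sq_abs]
    exact le_add_of_nonneg_right (sq_nonneg _)
  have hr : ‖residual Y x (d (j + 1)) (u (j + 1))‖ ≤ 1 / σ j * multiplierStep y z j := by
    rw [div_mul_eq_mul_div, one_mul, le_div_iff₀' hσ, ← sq_le_sq₀ (by positivity) hm0, hsq,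
      norm_smul, Real.norm_eq_abs, abs_of_pos hσ]
    exact le_add_of_nonneg_left (sq_nonneg _)
  refine (hj (d (j + 1)) (y (j + 1)) (z (j + 1)) g.snd g2).trans ?_
  rw [← g1, mul_assoc, mul_assoc]
  refine mul_le_mul_of_nonneg_left ?_ hC0
  rw [add_div, add_mul]
  linarith

end Problem
end ManPPA

/-! ### Assembly of the theorem -/

theorem proposition6 {n p : ℕ} (Y : Matrix (Fin n) (Fin p) ℝ) (x : ManPPA.Vec n) (hx : ‖x‖ = 1)
    (t : ℝ) (ht : 0 < t)
    (σ : ℕ → ℝ) (d : ℕ → ManPPA.Vec n) (u : ℕ → ManPPA.Vec p) (y : ℕ → ℝ) (z : ℕ → ManPPA.Vec p)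
    (hALM : ManPPA.IsInexactALM Y x σ d u y z)
    (ε : ℕ → ℝ) (hA : ManPPA.CriterionA Y x t σ d u y z ε) :
    (Bornology.IsBounded (Set.range fun j => ManPPA.primalPt (d j) (u j)) ∧
      ∃ w : ManPPA.Primal n p,
        ManPPA.IsOptimal Y x t w ∧ (∀ w', ManPPA.IsOptimal Y x t w' → w' = w) ∧
        Tendsto (fun j => ManPPA.primalPt (d j) (u j)) atTop (𝓝 w)) ∧
    (Tendsto σ atTop atTop →
      ∀ δ δ' : ℕ → ℝ,
        ManPPA.CriterionB Y x t σ d u y z δ → ManPPA.CriterionC Y x t σ d u y z δ' →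
        ManPPA.SuperlinearlyConvergesTo
          (fun j => ManPPA.primalDualPt (d j) (u j) (y j) (z j)) (ManPPA.kktSet Y x t)) := by
  obtain ⟨ds, us, ys, zs, h⟩ := ManPPA.exists_isKKT Y hx ht
  obtain ⟨hstep, hd, hu⟩ := h.tendsto_alm ht hALM hA
  have hlim : Tendsto (fun j => ManPPA.primalPt (d j) (u j)) atTop
      (𝓝 (ManPPA.primalPt ds us)) :=
    ((WithLp.prod_continuous_toLp 2 _ _).tendsto _).comp (hd.prodMk_nhds hu)
  refine ⟨⟨Metric.isBounded_range_of_tendsto _ hlim, ManPPA.primalPt ds us, h.isOptimal,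
    fun w' hw' => h.eq_of_isOptimal hw', hlim⟩, fun hσ δ δ' hB hC => ?_⟩
  have hne : (ManPPA.kktSet Y x t).Nonempty := ⟨_, h.mem ht⟩
  obtain ⟨C, hC0, hsucc⟩ := h.infDist_succ_le ht hALM hC hu
  have hθ : Tendsto (fun j => C * ((δ' j + 1) / σ j)) atTop (𝓝 0) := by
    have h1 := (hC.tendsto_zero.add_const 1).div_atTop hσ
    simpa using h1.const_mul C
  refine ⟨hne, ?_, fun j => C * ((δ' j + 1) / σ j) * 2, by simpa using hθ.mul_const 2, ?_⟩
  · refine (tendsto_add_atTop_iff_nat 1).1 ?_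
    refine squeeze_zero' (Eventually.of_forall fun j => Metric.infDist_nonneg) hsucc ?_
    simpa using hθ.mul hstep
  · filter_upwards [hsucc, ManPPA.multiplierStep_le_infDist ht hne hALM hB] with j h1 h2
    refine h1.trans ?_
    rw [mul_assoc _ (2 : ℝ)]
    refine mul_le_mul_of_nonneg_left h2 ?_
    have h3 := hALM.sigma_pos j
    have h4 := hC.nonneg j
    positivity
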